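/- For $q\ge 1$ let $\mathcal L_{q+1}=\{y\in\mathbb R^{q+1}: y_{q+1}\ge (y_1^2+\dots+y_q^2)^{1/2}\}$. A subset of $\mathbb R^d$ is called SOC representable if it is the projection onto the $x$-coordinates of a set $\{(x,u)\in\mathbb R^d\times\mathbb R^n: (\ell_{i1}(x,u),\ell_{i2}(x,u),\ell_{i3}(x,u))\in\mathcal L_3,\ i=1,\dots,m\}$ for some $n,m\ge 0$ and affine functions $\ell_{ij}$. Let $M>1$, $\mathcal R=[1/M,M]$, $D=[1/M^2,M^2]$, and for $\alpha\in\mathbb R$ let $$K_{\exp}(\alpha)=\{x\in\mathcal R^2\times\mathbb R:\ \log(x_1/x_2)\ge x_3/x_2-\alpha\}.$$ Let $\phi:[-1,1]\times D\to\mathbb R$ be a generating function for the logarithm, with constant $c\in\mathbb R$: for every $t\in[-1,1]$ the function $\phi(t,\cdot)$ is concave and continuous on $D$ and its hypograph $\operatorname{hyp}\phi(t)=\{(x,v): x\in D,\ \phi(t,x)\ge v\}$ is SOC representable; and for every $x\in D$ the function $\phi(\cdot,x)$ is integrable on $[-1,1]$ with $\int_{-1}^1\phi(t,x)\,dt=\log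 x+c$. Let $\rho>1$ and let $E_\rho=\{\tfrac{\rho}{2}e^{i\theta}+\tfrac{\rho^{-1}}{2}e^{-i\theta}:\theta\in[0,2\pi]\}$ be the Bernstein ellipse. Assume that for every $x\in D$ the function $\phi(\cdot,x)$ extends to a function, again written $\phi(\cdot,x)$, that is continuous on the closed region bounded by $E_\rho$ and analytic in its interior, and that $$\sup\{|\phi(z,x)|: x\in D,\ z\in E_\rho\}\le L<\infty .$$ For $N\ge 1$ let $t_1,\dots,t_N$ and $w_1,\dots,w_N$ be the nodes and weights of $N$-point Gauss quadrature on $[-1,1]$ (the nodes are the $N$ distinct roots of the Legendre polynomial of degree $N$, and $w_k$ is the integral over $[-1,1]$ of the $k$-th Lagrange basis polynomial of these nodes), and let $$\widehat K^{sc}_{\phi,N}=\Big\{x\in\mathcal R^2\times\mathbb R:\ \exists v\in\mathbb R^N,\ \sum_{k=1}^N w_kv_k\ge x_3+c\,x_2,\ (x_1/x_2,\,v_k/x_2)\in\operatorname{hyp}\phi(t_k)\ \text{for } k=1,\dots,N\Big\}.$$ Then there is an absolute constant $C>0$ (independent of $M,\phi,c,\rho,L,\varepsilon$) such that for every $\varepsilon>0$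 and every integer $N\ge C\,\bigl(1+\log_\rho(1+L/\varepsilon)\bigr)$, which is a threshold of order $O(\log_\rho(L/\varepsilon))$ as soon as $L/\varepsilon\ge\max(2,\rho)$, the set $\widehat K^{sc}_{\phi,N}$ is SOC representable and $$K_{\exp}(-\varepsilon)\subseteq \widehat K^{sc}_{\phi,N}\subseteq K_{\exp}(\varepsilon).$$ -/

import Mathlib

noncomputable section

namespace ExpCone

/-- The Lorentz cone `{y ∈ ℝ^{q+1} : y_{q+1} ≥ √(y_1² + ⋯ + y_q²)}`. -/
def lorentzCone (q : ℕ) : Set (Fin (q + 1) → ℝ) :=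
  {y | Real.sqrt (∑ i : Fin q, y i.castSucc ^ 2) ≤ y (Fin.last q)}

/-- A set is second-order-cone representable if it is the projection of a set cut out, in the
original variables `x` and finitely many auxiliary variables `u`, by finitely many conditions
"a triple of affine functions of `(x, u)` lies in the three-dimensional Lorentz cone". -/
def IsSOCRepresentable {E : Type*} [AddCommGroup E] [Module ℝ E] (S : Set E) : Prop :=
  ∃ (n m : ℕ) (a : Fin m → Fin 3 → (E × (Fin n → ℝ)) →ᵃ[ℝ] ℝ),
    S = {x | ∃ u : Fin n → ℝ, ∀ i : Fin m, (fun j : Fin 3 => a i j (x, u)) ∈ lorentzCone 2}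

/-- The hypograph of `φ(t, ·)` over the domain `D`. -/
def hypPhi (D : Set ℝ) (φ : ℝ → ℝ → ℝ) (t : ℝ) : Set (ℝ × ℝ) :=
  {p | p.1 ∈ D ∧ p.2 ≤ φ t p.1}

/-- `φ : [-1,1] × D → ℝ` is a generating function for the logarithm on `D`, with additive
constant `c` in the integral identity. Only values at `t ∈ [-1,1]`, `x ∈ D` matter. -/
structure IsGeneratingFunction (D : Set ℝ) (φ : ℝ → ℝ → ℝ) (c : ℝ) : Prop where
  concave : ∀ t ∈ Set.Icc (-1 : ℝ) 1, ConcaveOn ℝ D (φ t)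
  continuous : ∀ t ∈ Set.Icc (-1 : ℝ) 1, ContinuousOn (φ t) D
  soc : ∀ t ∈ Set.Icc (-1 : ℝ) 1, IsSOCRepresentable (hypPhi D φ t)
  integrable : ∀ x ∈ D, IntervalIntegrable (fun t => φ t x) MeasureTheory.volume (-1) 1
  integral_eq : ∀ x ∈ D, ∫ t in (-1 : ℝ)..1, φ t x = Real.log x + c

/-- The open region bounded by the Bernstein ellipse: foci `±1`, sum of semi-axes `ρ`. -/
def bernsteinRegion (ρ : ℝ) : Set ℂ :=
  {z | ‖z - 1‖ + ‖z + 1‖ < ρ + ρ⁻¹}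

/-- The point of the Bernstein ellipse with parameter `θ`. -/
def bernsteinPoint (ρ θ : ℝ) : ℂ :=
  (ρ : ℂ) / 2 * Complex.exp (Complex.I * θ) + (ρ : ℂ)⁻¹ / 2 * Complex.exp (-(Complex.I * θ))

/-- For every `x ∈ D`, the function `φ(·, x)` on `[-1,1]` has an analytic continuation to the
region bounded by the Bernstein ellipse, continuous up to the ellipse, and the absolute value of
the continuation is at most `L` on the ellipse, that is,
`sup {|φ(z, x)| : x ∈ D, z on the ellipse} ≤ L`. -/
def HasBernsteinBound (D : Set ℝ) (φ : ℝ → ℝ → ℝ) (ρ L : ℝ) : Prop :=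
  ∀ x ∈ D, ∃ F : ℂ → ℂ,
    DiffContOnCl ℂ F (bernsteinRegion ρ) ∧
    (∀ t ∈ Set.Icc (-1 : ℝ) 1, F (t : ℂ) = (φ t x : ℂ)) ∧
    ∀ θ ∈ Set.Icc (0 : ℝ) (2 * Real.pi), ‖F (bernsteinPoint ρ θ)‖ ≤ L

/-- The Legendre polynomial of degree `N` on `[-1,1]` (Rodrigues' formula). -/
def legendre (N : ℕ) : Polynomial ℝ :=
  Polynomial.C ((2 : ℝ) ^ N * (N.factorial : ℝ))⁻¹ *
    Polynomial.derivative^[N] ((Polynomial.X ^ 2 - 1) ^ N)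

/-- `N`-point Gauss quadrature on `[-1,1]`: the nodes are `N` distinct roots of the Legendre
polynomial of degree `N`, and the weights integrate the interpolating polynomial. -/
structure IsGaussQuadrature (N : ℕ) (t w : Fin N → ℝ) : Prop where
  injective : Function.Injective t
  isRoot : ∀ k, (legendre N).IsRoot (t k)
  weight_eq : ∀ k, w k = ∫ s in (-1 : ℝ)..1, (Lagrange.basis Finset.univ t k).eval s

/-- `hyp log (α) = {(x, v) : log x ≥ v - α}`. -/
def hypLog (α : ℝ) : Set (ℝ × ℝ) :=
  {p | 0 < p.1 ∧ p.2 - α ≤ Real.log p.1}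

/-- The parametric exponential cone, with `x₁, x₂ ∈ [1/M, M]`. -/
def Kexp (M α : ℝ) : Set (Fin 3 → ℝ) :=
  {x | x 0 ∈ Set.Icc (1 / M) M ∧ x 1 ∈ Set.Icc (1 / M) M ∧ (x 0 / x 1, x 2 / x 1) ∈ hypLog α}

/-- The range `[1/M², M²]` of the ratio `x₁ / x₂`. -/
def ratioRange (M : ℝ) : Set ℝ := Set.Icc (1 / M ^ 2) (M ^ 2)

/-- The approximating set built from the hypographs of `φ(t_k, ·)`. -/
def Ksc (M : ℝ) (φ : ℝ → ℝ → ℝ) (c : ℝ) {N : ℕ} (t w : Fin N → ℝ) : Set (Fin 3 → ℝ) :=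
  {x | x 0 ∈ Set.Icc (1 / M) M ∧ x 1 ∈ Set.Icc (1 / M) M ∧
    ∃ v : Fin N → ℝ, x 2 + c * x 1 ≤ ∑ k, w k * v k ∧
      ∀ k, (x 0 / x 1, v k / x 1) ∈ hypPhi (ratioRange M) φ (t k)}

end ExpCone

end

/-!
Gauss quadrature is exact for polynomials of degree less than `2 * N` and its weights are
nonnegative with sum `2`, so replacing `∫ φ(t, x) dt = log x + c` by `∑ k, w k * φ (t k) x` costs
at most four times the distance of `φ(·, x)` to these polynomials. Once this is at most `ε`
uniformly on `D`, the two inclusions are read off fibrewise. The approximating set is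
second-order-cone representable because the perspective of an affine function is linear.

Truncating the Chebyshev series of `φ(·, x)` at degree `n` leaves an error `O(L ρ⁻ⁿ / (ρ - 1))`,
which is not good enough for a constant independent of `ρ`. Instead, the low coefficients are
modified. Let `g(w) = φ((w + w⁻¹) / 2, x)`, which is analytic for `ρ⁻¹ < |w| < ρ`. For `0 < q < 1`
the Poisson kernel multiplied by `2 cos (n θ) / (qⁿ + q⁻ⁿ)` has `L¹` norm at most `2 qⁿ`, and its
Fourier multiplier is `q ^ |k|` for `|k| ≥ n`. With `q = ρ⁻¹`, apply this kernel to `g` on the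
circles of radii `ρ` and `ρ⁻¹`, add, and subtract the same construction with `q = ρ⁻²` on the unit
circle. As `ρ ^ (-|k|) * (ρ ^ k + ρ ^ (-k)) - ρ ^ (-2 * |k|) = 1`, this reproduces all frequencies
`|k| ≥ n` of `g`, so `g` is within `6 L ρ⁻ⁿ` of a trigonometric polynomial of degree less than `n`.
-/

namespace ExpCone

section Legendre

open Polynomial

theorem integral_eval_mul_derivative (p q : ℝ[X]) (a b : ℝ) :
    ∫ x in a..b, (p * derivative q).eval x =
      p.eval b * q.eval b - p.eval a * q.eval a - ∫ x in a..b, (derivative p * q).eval x := by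
  simp only [eval_mul]
  exact intervalIntegral.integral_mul_deriv_eq_deriv_mul
    (fun x _ ↦ p.hasDerivAt x) (fun x _ ↦ q.hasDerivAt x)
    ((derivative p).continuous.intervalIntegrable _ _)
    ((derivative q).continuous.intervalIntegrable _ _)

theorem integral_mul_iterate_derivative_eq_zero {p : ℝ[X]} {a b : ℝ} {n : ℕ}
    (ha : ∀ i < n, (derivative^[i] p).eval a = 0) (hb : ∀ i < n, (derivative^[i] p).eval b = 0)
    {q : ℝ[X]} (hq : q.degree < n) :
    ∫ x in a..b, (q * derivative^[n] p).eval x = 0 := by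
  induction n generalizing q with
  | zero =>
    obtain rfl : q = 0 := degree_eq_bot.mp (Nat.WithBot.lt_zero_iff.mp hq)
    simp
  | succ n ih =>
    have hq' : (derivative q).degree < n := by
      rcases eq_or_ne q 0 with rfl | hq0
      · simp
      · exact (degree_derivative_lt hq0).trans_le (degree_le_of_natDegree_le
          (Nat.lt_succ_iff.mp ((natDegree_lt_iff_degree_lt hq0).mpr hq)))
    rw [Function.iterate_succ_apply', integral_eval_mul_derivative, ha n n.lt_succ_self,
      hb n n.lt_succ_self, ih (fun i hi ↦ ha i (hi.trans n.lt_succ_self))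
        (fun i hi ↦ hb i (hi.trans n.lt_succ_self)) hq']
    simp

theorem eval_iterate_derivative_sq_sub_one_pow {n i : ℕ} (hi : i < n) {a : ℝ} (ha : a ^ 2 = 1) :
    (derivative^[i] ((X ^ 2 - 1 : ℝ[X]) ^ n)).eval a = 0 := by
  have hdvd : (X - C a) ^ n ∣ (X ^ 2 - 1 : ℝ[X]) ^ n :=
    pow_dvd_pow_of_dvd (dvd_iff_isRoot.mpr (by simp [ha])) n
  exact dvd_iff_isRoot.mp <| (dvd_pow_self (X - C a) (Nat.sub_ne_zero_of_lt hi)).trans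
    (pow_sub_dvd_iterate_derivative_of_pow_dvd i hdvd)

theorem integral_mul_legendre_eq_zero {N : ℕ} {q : ℝ[X]} (hq : q.degree < N) :
    ∫ x in (-1 : ℝ)..1, (q * legendre N).eval x = 0 := by
  have horth := integral_mul_iterate_derivative_eq_zero (p := (X ^ 2 - 1 : ℝ[X]) ^ N)
    (fun i hi ↦ eval_iterate_derivative_sq_sub_one_pow hi (by norm_num : (-1 : ℝ) ^ 2 = 1))
    (fun i hi ↦ eval_iterate_derivative_sq_sub_one_pow hi (one_pow 2)) hq
  simp only [legendre, mul_left_comm q, eval_C_mul, intervalIntegral.integral_const_mul, horth,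
    mul_zero]

theorem natDegree_legendre_le (N : ℕ) : (legendre N).natDegree ≤ N := by
  refine (natDegree_C_mul_le _ _).trans ((natDegree_iterate_derivative _ _).trans ?_)
  have hdeg : ((X ^ 2 - 1 : ℝ[X]) ^ N).natDegree ≤ N * 2 :=
    natDegree_pow_le.trans (Nat.mul_le_mul le_rfl (by compute_degree))
  lia

theorem card_roots_le_iterate_derivative (p : ℝ[X]) (n : ℕ) :
    p.roots.card ≤ (derivative^[n] p).roots.card + n := by
  induction n with
  | zero => simp
  | succ n ih =>
    rw [Function.iterate_succ_apply']
    have := card_roots_le_derivative (derivative^[n] p)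
    lia

theorem le_card_roots_legendre (N : ℕ) : N ≤ (legendre N).roots.card := by
  have hfactor : (X ^ 2 - 1 : ℝ[X]) = (X - C 1) * (X - C (-1)) := by
    rw [C_neg, C_1]
    ring
  have hcard : ((X ^ 2 - 1 : ℝ[X]) ^ N).roots.card = 2 * N := by
    rw [roots_pow, hfactor, roots_mul (mul_ne_zero (X_sub_C_ne_zero _) (X_sub_C_ne_zero _)),
      roots_X_sub_C, roots_X_sub_C]
    simp [mul_comm]
  have hRolle := card_roots_le_iterate_derivative ((X ^ 2 - 1 : ℝ[X]) ^ N) N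
  rw [legendre, roots_C_mul _ (by positivity)]
  lia

theorem card_roots_legendre (N : ℕ) : (legendre N).roots.card = N :=
  ((card_roots' _).trans (natDegree_legendre_le N)).antisymm (le_card_roots_legendre N)

theorem natDegree_legendre (N : ℕ) : (legendre N).natDegree = N :=
  (natDegree_legendre_le N).antisymm ((le_card_roots_legendre N).trans (card_roots' _))

theorem legendre_ne_zero (N : ℕ) : legendre N ≠ 0 := by
  intro h
  obtain rfl : N = 0 := by simpa [h] using (natDegree_legendre N).symm
  simp [legendre] at h

theorem degree_legendre (N : ℕ) : (legendre N).degree = N := by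
  rw [degree_eq_natDegree (legendre_ne_zero N), natDegree_legendre]

theorem eq_zero_of_nonneg_of_integral_eq_zero {p : ℝ[X]} {a b : ℝ} (hab : a < b)
    (hp : ∀ x ∈ Set.Icc a b, 0 ≤ p.eval x) (h_int : ∫ x in a..b, p.eval x = 0) : p = 0 := by
  refine eq_zero_of_infinite_isRoot p ((Set.Icc_infinite hab).mono fun x hx ↦ ?_)
  by_contra hne
  exact (intervalIntegral.integral_pos hab p.continuous.continuousOn
    (fun y hy ↦ hp y (Set.Ioc_subset_Icc_self hy))
    ⟨x, hx, (hp x hx).lt_of_ne' hne⟩).ne' h_int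

theorem eq_zero_of_mul_legendre_nonneg {N : ℕ} {q : ℝ[X]} (hq : q.degree < N)
    (hnonneg : ∀ x ∈ Set.Icc (-1 : ℝ) 1, 0 ≤ (q * legendre N).eval x) : q = 0 :=
  (mul_eq_zero.mp (eq_zero_of_nonneg_of_integral_eq_zero (by norm_num) hnonneg
    (integral_mul_legendre_eq_zero hq))).resolve_right (legendre_ne_zero N)

theorem degree_lt_of_legendre_eq_mul {N : ℕ} {p q : ℝ[X]} (h : legendre N = p * q)
    (hp : 0 < p.natDegree) : q ≠ 0 ∧ q.degree < N := by
  have hpq : p ≠ 0 ∧ q ≠ 0 := mul_ne_zero_iff.mp (h ▸ legendre_ne_zero N)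
  have hdeg := natDegree_mul hpq.1 hpq.2
  rw [← h, natDegree_legendre] at hdeg
  exact ⟨hpq.2, (natDegree_lt_iff_degree_lt hpq.2).mp (by lia)⟩

theorem mem_Ioo_of_isRoot_legendre {N : ℕ} {t : ℝ} (ht : (legendre N).IsRoot t) :
    t ∈ Set.Ioo (-1 : ℝ) 1 := by
  obtain ⟨q, hfactor⟩ := dvd_iff_isRoot.mpr ht
  obtain ⟨hq0, hq⟩ := degree_lt_of_legendre_eq_mul hfactor (by simp)
  have heval (x : ℝ) : (q * legendre N).eval x = (x - t) * q.eval x ^ 2 := by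
    simp only [hfactor, eval_mul, eval_sub, eval_X, eval_C]
    ring
  by_contra hmem
  rw [Set.mem_Ioo, not_and_or, not_lt, not_lt] at hmem
  rcases hmem with ht | ht
  · refine hq0 (eq_zero_of_mul_legendre_nonneg hq fun x hx ↦ ?_)
    rw [heval]
    exact mul_nonneg (by linarith [hx.1]) (sq_nonneg _)
  · refine hq0 (neg_eq_zero.mp (eq_zero_of_mul_legendre_nonneg (degree_neg q ▸ hq) fun x hx ↦ ?_))
    rw [neg_mul, eval_neg, heval, ← neg_mul]
    exact mul_nonneg (by linarith [hx.2]) (sq_nonneg _)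

theorem nodup_roots_legendre (N : ℕ) : (legendre N).roots.Nodup := by
  rw [Multiset.nodup_iff_count_le_one]
  intro t
  rw [count_roots]
  by_contra! hmult
  obtain ⟨q, hfactor⟩ := (le_rootMultiplicity_iff (legendre_ne_zero N)).mp hmult
  obtain ⟨hq0, hq⟩ := degree_lt_of_legendre_eq_mul hfactor (by simp)
  refine hq0 (eq_zero_of_mul_legendre_nonneg hq fun x _ ↦ ?_)
  calc 0 ≤ ((x - t) * q.eval x) ^ 2 := sq_nonneg _
    _ = (q * legendre N).eval x := by
      simp only [hfactor, eval_mul, eval_sub, eval_X, eval_C, eval_pow]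
      ring

end Legendre

section GaussQuadrature

open Polynomial

theorem abs_integral_sub_sum_le {ι : Type*} [Fintype ι] {a b : ℝ} (hab : a ≤ b) {t w : ι → ℝ}
    (ht : ∀ k, t k ∈ Set.Icc a b) (hw : ∀ k, 0 ≤ w k) {m : ℕ} (hm : 0 < m)
    (hexact : ∀ p : ℝ[X], p.degree < m → ∫ x in a..b, p.eval x = ∑ k, w k * p.eval (t k))
    {f : ℝ → ℝ} (hf : IntervalIntegrable f MeasureTheory.volume a b)
    {p : ℝ[X]} (hp : p.degree < m) {δ : ℝ} (hδ : ∀ x ∈ Set.Icc a b, |f x - p.eval x| ≤ δ) :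
    |(∫ x in a..b, f x) - ∑ k, w k * f (t k)| ≤ 2 * (b - a) * δ := by
  have hintegral : |∫ x in a..b, (f x - p.eval x)| ≤ δ * (b - a) := by
    rw [← abs_of_nonneg (sub_nonneg.mpr hab), ← Real.norm_eq_abs]
    exact intervalIntegral.norm_integral_le_of_norm_le_const fun x hx ↦
      hδ x (Set.Ioc_subset_Icc_self (Set.uIoc_of_le hab ▸ hx))
  have hweights : ∑ k, w k = b - a := by
    simpa using (hexact 1 (by simpa using hm)).symm
  have hsum : |∑ k, w k * (f (t k) - p.eval (t k))| ≤ δ * (b - a) :=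
    calc |∑ k, w k * (f (t k) - p.eval (t k))|
        ≤ ∑ k, |w k * (f (t k) - p.eval (t k))| := Finset.abs_sum_le_sum_abs _ _
      _ ≤ ∑ k, w k * δ := by
        refine Finset.sum_le_sum fun k _ ↦ ?_
        rw [abs_mul, abs_of_nonneg (hw k)]
        exact mul_le_mul_of_nonneg_left (hδ _ (ht k)) (hw k)
      _ = δ * (b - a) := by rw [← Finset.sum_mul, hweights, mul_comm]
  have hsplit : (∫ x in a..b, f x) - ∑ k, w k * f (t k) =
      (∫ x in a..b, (f x - p.eval x)) - ∑ k, w k * (f (t k) - p.eval (t k)) := by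
    rw [intervalIntegral.integral_sub hf (p.continuous.intervalIntegrable _ _), hexact p hp]
    simp only [mul_sub, Finset.sum_sub_distrib]
    ring
  rw [hsplit]
  linarith [abs_sub (∫ x in a..b, (f x - p.eval x)) (∑ k, w k * (f (t k) - p.eval (t k)))]

theorem exists_isGaussQuadrature (N : ℕ) : ∃ t w : Fin N → ℝ, IsGaussQuadrature N t w := by
  have hcard : (legendre N).roots.toFinset.card = N := by
    rw [Multiset.toFinset_card_of_nodup (nodup_roots_legendre N), card_roots_legendre]
  let e := (legendre N).roots.toFinset.equivFinOfCardEq hcard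
  exact ⟨fun k ↦ e.symm k, _, Subtype.val_injective.comp e.symm.injective,
    fun k ↦ isRoot_of_mem_roots (Multiset.mem_toFinset.mp (e.symm k).2), fun _ ↦ rfl⟩

namespace IsGaussQuadrature

variable {N : ℕ} {t w : Fin N → ℝ}

theorem integral_eq_sum_of_degree_lt (h : IsGaussQuadrature N t w) {p : ℝ[X]} (hp : p.degree < N) :
    ∫ x in (-1 : ℝ)..1, p.eval x = ∑ k, w k * p.eval (t k) := by
  have hinterp := Lagrange.eq_interpolate (s := Finset.univ) h.injective.injOn
    (by simpa using hp : p.degree < (Finset.univ : Finset (Fin N)).card)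
  have heval (x : ℝ) :
      p.eval x = ∑ k, p.eval (t k) * (Lagrange.basis Finset.univ t k).eval x := by
    conv_lhs => rw [hinterp]
    simp only [Lagrange.interpolate_apply, eval_finsetSum, eval_mul, eval_C]
  rw [intervalIntegral.integral_congr fun x _ ↦ heval x, intervalIntegral.integral_finsetSum
    fun k _ ↦ ((Lagrange.basis Finset.univ t k).continuous.const_mul _).intervalIntegrable _ _]
  refine Finset.sum_congr rfl fun k _ ↦ ?_
  rw [intervalIntegral.integral_const_mul, h.weight_eq, mul_comm]

theorem integral_eq_sum (h : IsGaussQuadrature N t w) {p : ℝ[X]} (hp : p.degree < (2 * N : ℕ)) :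
    ∫ x in (-1 : ℝ)..1, p.eval x = ∑ k, w k * p.eval (t k) := by
  set q := p / legendre N
  set r := p % legendre N
  have hdiv : q * legendre N + r = p := by
    rw [mul_comm]
    exact EuclideanDomain.div_add_mod p (legendre N)
  have hr : r.degree < N := degree_legendre N ▸ degree_mod_lt p (legendre_ne_zero N)
  have hq : q.degree < N := by
    rcases eq_or_ne q 0 with hq0 | hq0
    · rw [hq0, degree_zero]
      exact WithBot.bot_lt_coe N
    have hmul : (q * legendre N).degree < (2 * N : ℕ) := by
      rw [eq_sub_of_add_eq hdiv]
      exact (degree_sub_le p r).trans_lt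
        (max_lt hp (hr.trans_le (by exact_mod_cast (by lia : N ≤ 2 * N))))
    rw [← natDegree_lt_iff_degree_lt (mul_ne_zero hq0 (legendre_ne_zero N)),
      natDegree_mul hq0 (legendre_ne_zero N), natDegree_legendre] at hmul
    exact (natDegree_lt_iff_degree_lt hq0).mp (by lia)
  have heval (x : ℝ) : p.eval x = (q * legendre N).eval x + r.eval x := by rw [← eval_add, hdiv]
  have hnode (k : Fin N) : p.eval (t k) = r.eval (t k) := by
    rw [heval, eval_mul, h.isRoot k, mul_zero, zero_add]
  rw [intervalIntegral.integral_congr fun x _ ↦ heval x, intervalIntegral.integral_add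
    ((q * legendre N).continuous.intervalIntegrable _ _) (r.continuous.intervalIntegrable _ _),
    integral_mul_legendre_eq_zero hq, zero_add, h.integral_eq_sum_of_degree_lt hr]
  simp only [hnode]

theorem weight_nonneg (h : IsGaussQuadrature N t w) (k : Fin N) : 0 ≤ w k := by
  set ℓ := Lagrange.basis Finset.univ t k
  have hdeg : (ℓ ^ 2).degree < (2 * N : ℕ) := by
    refine degree_le_natDegree.trans_lt ?_
    rw [natDegree_pow, Lagrange.natDegree_basis h.injective.injOn (Finset.mem_univ k),
      Finset.card_univ, Fintype.card_fin]
    exact mod_cast (by have := k.pos; lia : 2 * (N - 1) < 2 * N)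
  have hself : ℓ.eval (t k) = 1 := Lagrange.eval_basis_self h.injective.injOn (Finset.mem_univ k)
  have hother : ∀ j ∈ Finset.univ, j ≠ k → w j * (ℓ ^ 2).eval (t j) = 0 := fun j hj hjk ↦ by
    rw [eval_pow, Lagrange.eval_basis_of_ne hjk.symm hj, zero_pow two_ne_zero, mul_zero]
  calc 0 ≤ ∫ x in (-1 : ℝ)..1, (ℓ ^ 2).eval x :=
        intervalIntegral.integral_nonneg (by norm_num) fun x _ ↦ by
          rw [eval_pow]
          positivity
    _ = w k := by
      rw [h.integral_eq_sum hdeg, Finset.sum_eq_single k hother (by simp), eval_pow, hself, one_pow,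
        mul_one]

theorem node_mem_Icc (h : IsGaussQuadrature N t w) (k : Fin N) : t k ∈ Set.Icc (-1 : ℝ) 1 :=
  Set.Ioo_subset_Icc_self (mem_Ioo_of_isRoot_legendre (h.isRoot k))

end IsGaussQuadrature

end GaussQuadrature

section SOCRepresentable

variable {E F : Type*} [AddCommGroup E] [Module ℝ E] [AddCommGroup F] [Module ℝ F]

theorem mem_lorentzCone_two {y : Fin 3 → ℝ} :
    y ∈ lorentzCone 2 ↔ Real.sqrt (y 0 ^ 2 + y 1 ^ 2) ≤ y 2 := by
  simp [lorentzCone, Fin.sum_univ_two, Fin.last]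

theorem mul_mem_lorentzCone_two {y : Fin 3 → ℝ} {s : ℝ} (hs : 0 < s) :
    (fun j ↦ s * y j) ∈ lorentzCone 2 ↔ y ∈ lorentzCone 2 := by
  have hsq : (s * y 0) ^ 2 + (s * y 1) ^ 2 = s ^ 2 * (y 0 ^ 2 + y 1 ^ 2) := by ring
  rw [mem_lorentzCone_two, mem_lorentzCone_two, hsq, Real.sqrt_mul (sq_nonneg s),
    Real.sqrt_sq hs.le, mul_le_mul_iff_right₀ hs]

theorem isSOCRepresentable_of_finite {ι κ : Type*} [Finite ι] [Finite κ]
    (a : ι → Fin 3 → (E × (κ → ℝ)) →ᵃ[ℝ] ℝ) :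
    IsSOCRepresentable {x | ∃ u : κ → ℝ, ∀ i, (fun j ↦ a i j (x, u)) ∈ lorentzCone 2} := by
  let eι := Finite.equivFin ι
  let eκ := Finite.equivFin κ
  let T : (E × (Fin (Nat.card κ) → ℝ)) →ₗ[ℝ] (E × (κ → ℝ)) :=
    LinearMap.prodMap LinearMap.id (LinearMap.funLeft ℝ ℝ eκ)
  refine ⟨_, _, fun i j ↦ (a (eι.symm i) j).comp T.toAffineMap, Set.ext fun x ↦ ?_⟩
  exact (eκ.arrowCongr (Equiv.refl ℝ)).exists_congr fun u ↦ eι.forall_congr fun i ↦ by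
    have hT : T (x, eκ.arrowCongr (Equiv.refl ℝ) u) = (x, u) := by
      ext <;> simp [T, LinearMap.funLeft]
    simp [hT]

theorem isSOCRepresentable_setOf_le (f g : E →ᵃ[ℝ] ℝ) : IsSOCRepresentable {x | f x ≤ g x} := by
  convert isSOCRepresentable_of_finite (ι := Unit) (κ := Empty)
    (fun _ ↦ ![0, 0, (g - f).comp (LinearMap.fst ℝ E _).toAffineMap]) using 1
  ext x
  simp [mem_lorentzCone_two]

namespace IsSOCRepresentable

theorem iInter {ι : Type*} [Finite ι] {S : ι → Set E} (hS : ∀ i, IsSOCRepresentable (S i)) :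
    IsSOCRepresentable (⋂ i, S i) := by
  choose n m a ha using hS
  let T (i : ι) : (E × ((Σ i, Fin (n i)) → ℝ)) →ₗ[ℝ] (E × (Fin (n i) → ℝ)) :=
    LinearMap.prodMap LinearMap.id (LinearMap.funLeft ℝ ℝ fun k ↦ ⟨i, k⟩)
  convert isSOCRepresentable_of_finite (ι := Σ i, Fin (m i))
    (fun q j ↦ (a q.1 q.2 j).comp (T q.1).toAffineMap) using 1
  ext x
  simp only [Set.mem_iInter, ha, Set.mem_ofPred_eq, Sigma.forall]
  refine ⟨fun h ↦ ?_, fun ⟨u, hu⟩ i ↦ ⟨_, hu i⟩⟩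
  choose u hu using h
  exact ⟨fun q ↦ u q.1 q.2, hu⟩

theorem inter {S T : Set E} (hS : IsSOCRepresentable S) (hT : IsSOCRepresentable T) :
    IsSOCRepresentable (S ∩ T) := by
  rw [Set.inter_eq_iInter]
  exact iInter (Bool.forall_bool.mpr ⟨hT, hS⟩)

theorem preimage {S : Set F} (hS : IsSOCRepresentable S) (f : E →ᵃ[ℝ] F) :
    IsSOCRepresentable (f ⁻¹' S) := by
  obtain ⟨n, m, a, rfl⟩ := hS
  exact ⟨n, m, fun i j ↦ (a i j).comp (f.prodMap (AffineMap.id ℝ _)), rfl⟩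

theorem setOf_exists {κ : Type*} [Finite κ] {S : Set (E × (κ → ℝ))} (hS : IsSOCRepresentable S) :
    IsSOCRepresentable {x | ∃ v, (x, v) ∈ S} := by
  obtain ⟨n, m, a, rfl⟩ := hS
  let T : (E × (κ ⊕ Fin n → ℝ)) →ₗ[ℝ] ((E × (κ → ℝ)) × (Fin n → ℝ)) :=
    (LinearMap.prodMap LinearMap.id (LinearMap.funLeft ℝ ℝ Sum.inl)).prod
      ((LinearMap.funLeft ℝ ℝ Sum.inr).comp (LinearMap.snd ℝ _ _))
  convert isSOCRepresentable_of_finite (fun i j => (a i j).comp T.toAffineMap) using 1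
  ext x
  exact ⟨fun ⟨v, u, h⟩ ↦ ⟨Sum.elim v u, h⟩, fun ⟨u, h⟩ ↦ ⟨u ∘ Sum.inl, u ∘ Sum.inr, h⟩⟩

end IsSOCRepresentable

/-- The perspective `(y, s) ↦ s * f (y / s)` of an affine function `f`; it is linear in `(y, s)`,
and at `s = 0` it is the linear part of `f`. -/
def perspective (f : F →ᵃ[ℝ] ℝ) : F × ℝ →ₗ[ℝ] ℝ :=
  f.linear.comp (LinearMap.fst ℝ F ℝ) + f 0 • LinearMap.snd ℝ F ℝ

theorem perspective_smul (f : F →ᵃ[ℝ] ℝ) (y : F) (s : ℝ) :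
    perspective f (s • y, s) = s * f y := by
  rw [congrFun f.decomp y]
  simp [perspective]
  ring

theorem IsSOCRepresentable.setOf_inv_smul_mem {S : Set F} (hS : IsSOCRepresentable S) {δ : ℝ}
    (hδ : 0 < δ) : IsSOCRepresentable {p : F × ℝ | δ ≤ p.2 ∧ p.2⁻¹ • p.1 ∈ S} := by
  obtain ⟨n, m, a, rfl⟩ := hS
  let T : ((F × ℝ) × (Fin n → ℝ)) →ₗ[ℝ] ((F × (Fin n → ℝ)) × ℝ) :=
    ((LinearMap.fst ℝ F ℝ).prodMap LinearMap.id).prod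
      ((LinearMap.snd ℝ F ℝ).comp (LinearMap.fst ℝ _ _))
  convert (isSOCRepresentable_setOf_le (AffineMap.const ℝ (F × ℝ) δ)
    (LinearMap.snd ℝ F ℝ).toAffineMap).inter (isSOCRepresentable_of_finite
      fun i j ↦ ((perspective (a i j)).comp T).toAffineMap) using 1
  ext ⟨y, s⟩
  refine and_congr_right fun hs ↦ ?_
  have hs : 0 < s := hδ.trans_le hs
  have hT (u : Fin n → ℝ) : T ((y, s), s • u) = (s • (s⁻¹ • y, u), s) := by
    simp [T, smul_smul, hs.ne']
  refine (MulAction.toPerm (Units.mk0 s hs.ne')).exists_congr fun u ↦ forall_congr' fun i ↦ ?_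
  rw [← mul_mem_lorentzCone_two hs]
  simp only [← perspective_smul, ← hT]
  rfl

theorem isSOCRepresentable_Ksc {M : ℝ} (hM : 0 < M) {φ : ℝ → ℝ → ℝ} (c : ℝ) {N : ℕ}
    {t : Fin N → ℝ} (w : Fin N → ℝ)
    (h : ∀ k, IsSOCRepresentable (hypPhi (ratioRange M) φ (t k))) :
    IsSOCRepresentable (Ksc M φ c t w) := by
  let x (i : Fin 3) : (Fin 3 → ℝ) × (Fin N → ℝ) →ₗ[ℝ] ℝ := (LinearMap.proj i).comp (.fst ℝ _ _)
  let v (k : Fin N) : (Fin 3 → ℝ) × (Fin N → ℝ) →ₗ[ℝ] ℝ := (LinearMap.proj k).comp (.snd ℝ _ _)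
  have hrange (i : Fin 3) : IsSOCRepresentable {p | x i p ∈ Set.Icc (1 / M) M} :=
    (isSOCRepresentable_setOf_le (.const ℝ _ (1 / M)) (x i).toAffineMap).inter
      (isSOCRepresentable_setOf_le (x i).toAffineMap (.const ℝ _ M))
  have hsum : IsSOCRepresentable {p | (x 2 + c • x 1) p ≤ (∑ k, w k • v k) p} :=
    isSOCRepresentable_setOf_le (x 2 + c • x 1).toAffineMap (∑ k, w k • v k).toAffineMap
  have hhyp := IsSOCRepresentable.iInter fun k ↦
    ((h k).setOf_inv_smul_mem (one_div_pos.mpr hM)).preimage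
      (((x 0).prod (v k)).prod (x 1)).toAffineMap
  convert (((hrange 0).inter (hrange 1)).inter (hsum.inter hhyp)).setOf_exists using 1
  ext y
  simp +contextual [Ksc, x, v, div_eq_inv_mul, and_assoc]

end SOCRepresentable

section FourierSeries

open Complex MeasureTheory Metric

theorem norm_circleAverage_le_of_norm_le {E : Type*} [NormedAddCommGroup E] [NormedSpace ℝ E]
    {f : ℂ → E} {b : ℂ → ℝ} {c : ℂ} {R : ℝ} (hb : CircleIntegrable b c R)
    (hfb : ∀ z ∈ sphere c |R|, ‖f z‖ ≤ b z) :
    ‖Real.circleAverage f c R‖ ≤ Real.circleAverage b c R := by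
  have htwo_pi : (0 : ℝ) ≤ 2 * Real.pi := by positivity
  rw [Real.circleAverage_def, Real.circleAverage_def, norm_smul, smul_eq_mul,
    Real.norm_of_nonneg (inv_nonneg.mpr htwo_pi)]
  gcongr
  exact intervalIntegral.norm_integral_le_of_norm_le htwo_pi
    (Filter.Eventually.of_forall fun θ _ ↦ hfb _ (circleMap_mem_sphere' c R θ)) hb

theorem summable_pow_natAbs {q : ℝ} (hq0 : 0 ≤ q) (hq1 : q < 1) :
    Summable fun k : ℤ ↦ q ^ k.natAbs := by
  have hnatAbs (n : ℕ) : (-((n : ℤ) + 1)).natAbs = n + 1 := by omega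
  have hgeom := summable_geometric_of_lt_one hq0 hq1
  refine .of_nat_of_neg_add_one (by simpa only [Int.natAbs_natCast] using hgeom) ?_
  simpa only [hnatAbs] using (summable_nat_add_iff 1).mpr hgeom

theorem summable_pow_natAbs_sub {q : ℝ} (hq0 : 0 ≤ q) (hq1 : q < 1) (n : ℤ) :
    Summable fun k : ℤ ↦ q ^ (k - n).natAbs :=
  (summable_pow_natAbs hq0 hq1).comp_injective (Equiv.subRight n).injective

theorem hasSum_pow_natAbs_mul_zpow {q : ℝ} (hq0 : 0 ≤ q) (hq1 : q < 1) {v : ℂ} (hv : ‖v‖ = 1) :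
    HasSum (fun k : ℤ ↦ (q ^ k.natAbs : ℂ) * v ^ k) (((1 - q ^ 2) / ‖1 - q * v‖ ^ 2 : ℝ) : ℂ) := by
  have hv0 : v ≠ 0 := norm_ne_zero_iff.mp (hv ▸ one_ne_zero)
  have hnorm : ‖q * v‖ < 1 := by simpa [hv, abs_of_nonneg hq0] using hq1
  have hnorm' : ‖q * v⁻¹‖ < 1 := by simpa [hv, abs_of_nonneg hq0] using hq1
  have hne {z : ℂ} (hz : ‖z‖ < 1) : 1 - z ≠ 0 :=
    fun h ↦ by simp [← sub_eq_zero.mp h] at hz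
  have hsq : ((‖1 - q * v‖ ^ 2 : ℝ) : ℂ) = (1 - q * v) * (1 - q * v⁻¹) := by
    rw [← normSq_eq_norm_sq, ← mul_conj, map_sub, map_one, map_mul, conj_ofReal,
      inv_eq_conj hv]
  have hval : (((1 - q ^ 2) / ‖1 - q * v‖ ^ 2 : ℝ) : ℂ) =
      (1 - q * v)⁻¹ + q * v⁻¹ * (1 - q * v⁻¹)⁻¹ := by
    rw [ofReal_div, hsq, ofReal_sub, ofReal_pow, ofReal_one]
    have hprod : q * v * (q * v⁻¹) = (q : ℂ) ^ 2 := by field_simp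
    rw [← hprod, div_eq_iff (mul_ne_zero (hne hnorm) (hne hnorm'))]
    linear_combination (-(1 - q * v⁻¹)) * inv_mul_cancel₀ (hne hnorm) -
      q * v⁻¹ * (1 - q * v) * inv_mul_cancel₀ (hne hnorm')
  rw [hval]
  refine .of_nat_of_neg_add_one ?_ ?_
  · simpa [mul_pow] using hasSum_geometric_of_norm_lt_one hnorm
  · have hterm (n : ℕ) : (q ^ (-((n : ℤ) + 1)).natAbs : ℂ) * v ^ (-((n : ℤ) + 1)) =
        q * v⁻¹ * (q * v⁻¹) ^ n := by
      have hnatAbs : (-((n : ℤ) + 1)).natAbs = n + 1 := by omega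
      rw [hnatAbs, zpow_neg, ← inv_zpow, ← pow_succ', mul_pow]
      norm_cast
    simpa only [hterm] using (hasSum_geometric_of_norm_lt_one hnorm').mul_left (q * v⁻¹)

theorem poissonKernel_zero_ofReal_mul {q : ℝ} {w z : ℂ} (hw : ‖w‖ = 1) (hz : ‖z‖ = 1) :
    poissonKernel 0 (q * w) z = (1 - q ^ 2) / ‖1 - q * (w / z)‖ ^ 2 := by
  have hz0 : z ≠ 0 := norm_ne_zero_iff.mp (hz ▸ one_ne_zero)
  have : z - q * w = z * (1 - q * (w / z)) := by field_simp
  simp [poissonKernel_def, this, hw, hz]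

/-- The `k`-th Fourier (Laurent) coefficient of a function on the unit circle. -/
noncomputable def circleCoeff (f : ℂ → ℂ) (k : ℤ) : ℂ :=
  Real.circleAverage (fun z ↦ z ^ (-k) * f z) 0 1

section UnitCircle

variable {f : ℂ → ℂ} {B : ℝ}

theorem circleCoeff_zpow_mul (n k : ℤ) :
    circleCoeff (fun z ↦ z ^ n * f z) k = circleCoeff f (k - n) := by
  refine Real.circleAverage_congr_sphere fun z hz ↦ ?_
  have hz0 : z ≠ 0 := ne_of_mem_sphere hz (by simp)
  simp only [← mul_assoc, ← zpow_add₀ hz0, neg_sub, neg_add_eq_sub]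

theorem norm_circleCoeff_le (hB : ∀ z, ‖z‖ = 1 → ‖f z‖ ≤ B) (k : ℤ) : ‖circleCoeff f k‖ ≤ B := by
  refine (norm_circleAverage_le_of_norm_le (b := fun _ ↦ B) (by fun_prop) fun z hz ↦ ?_).trans_eq
    (Real.circleAverage_const B 0 1)
  have hz : ‖z‖ = 1 := by simpa using hz
  simpa [hz] using hB z hz

theorem summable_mul_circleCoeff (hB : ∀ z, ‖z‖ = 1 → ‖f z‖ ≤ B) {w : ℂ} (hw : ‖w‖ = 1)
    {m : ℤ → ℝ} (hm : Summable m) :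
    Summable fun k : ℤ ↦ (m k : ℂ) * (circleCoeff f k * w ^ k) := by
  refine .of_norm_bounded (hm.norm.mul_right B) fun k ↦ ?_
  rw [norm_mul, norm_mul, norm_zpow, hw, one_zpow, mul_one, norm_real]
  gcongr
  exact norm_circleCoeff_le hB k

theorem hasSum_circleAverage_poissonKernel {q : ℝ} (hq0 : 0 ≤ q) (hq1 : q < 1)
    (hf : ContinuousOn f (sphere 0 1)) {w : ℂ} (hw : ‖w‖ = 1) :
    HasSum (fun k : ℤ ↦ (q ^ k.natAbs : ℂ) * (circleCoeff f k * w ^ k))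
      (Real.circleAverage (fun z ↦ poissonKernel 0 (q * w) z • f z) 0 1) := by
  have hfc : Continuous fun θ ↦ f (circleMap 0 1 θ) :=
    hf.comp_continuous (continuous_circleMap 0 1) (circleMap_mem_sphere 0 zero_le_one)
  obtain ⟨B, hB⟩ := (isCompact_sphere (0 : ℂ) 1).exists_bound_of_continuousOn hf
  have hterm : ∀ k : ℤ, (q ^ k.natAbs : ℂ) * (circleCoeff f k * w ^ k) =
      Real.circleAverage (fun z ↦ (q ^ k.natAbs : ℂ) * (w / z) ^ k * f z) 0 1 := fun k ↦ by
    rw [circleCoeff, mul_comm _ (w ^ k), ← mul_assoc, ← smul_eq_mul, ← Real.circleAverage_fun_smul]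
    simp only [smul_eq_mul, div_eq_mul_inv, mul_zpow, inv_zpow, zpow_neg, mul_assoc]
  simp only [hterm, Real.circleAverage_def]
  refine (intervalIntegral.hasSum_integral_of_dominated_convergence
    (fun (k : ℤ) _ ↦ q ^ k.natAbs * B) (fun k ↦ ?_) (fun k ↦ .of_forall fun θ _ ↦ ?_)
    (.of_forall fun θ _ ↦ (summable_pow_natAbs hq0 hq1).mul_right B) intervalIntegrable_const
    (.of_forall fun θ _ ↦ ?_)).const_smul _
  · simp only [div_zpow]
    have hz (θ : ℝ) : circleMap 0 1 θ ≠ 0 := circleMap_ne_center one_ne_zero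
    have hpow : Continuous fun θ ↦ circleMap 0 1 θ ^ k :=
      (continuous_circleMap 0 1).zpow₀ k fun θ ↦ .inl (hz θ)
    exact ((continuous_const.mul (continuous_const.div hpow fun θ ↦ zpow_ne_zero k (hz θ))).mul
      hfc).aestronglyMeasurable
  · rw [norm_mul, norm_mul, norm_zpow, norm_div, hw, norm_circleMap_zero, abs_one, div_one,
      one_zpow, mul_one, norm_pow, norm_real, Real.norm_of_nonneg hq0]
    gcongr
    exact hB _ (circleMap_mem_sphere 0 zero_le_one θ)
  · have hz : ‖circleMap 0 1 θ‖ = 1 := by simp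
    rw [poissonKernel_zero_ofReal_mul hw hz, real_smul]
    exact (hasSum_pow_natAbs_mul_zpow hq0 hq1 (by rw [norm_div, hw, hz, div_one])).mul_right _

theorem norm_circleAverage_poissonKernel_le {c u : ℂ} {R : ℝ} (hu : u ∈ ball c R)
    (hB : ∀ z ∈ sphere c R, ‖f z‖ ≤ B) :
    ‖Real.circleAverage (fun z ↦ poissonKernel c u z • f z) c R‖ ≤ B := by
  have hR : |R| = R := abs_of_pos (pos_of_mem_ball hu)
  have hnonneg : ∀ z ∈ sphere c R, 0 ≤ poissonKernel c u z := fun z hz ↦ by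
    rw [mem_sphere_iff_norm] at hz
    rw [mem_ball_iff_norm] at hu
    rw [poissonKernel_def, hz]
    exact div_nonneg (sub_nonneg.mpr (pow_le_pow_left₀ (norm_nonneg _) hu.le 2)) (sq_nonneg _)
  have h_int : CircleIntegrable (fun z ↦ poissonKernel c u z * B) c R := by
    rw [poissonKernel_eq_re_herglotzRieszKernel]
    exact ((continuous_re.comp_continuousOn
      (continuousOn_herglotzRieszKernel_sphere hu)).mul continuousOn_const).circleIntegrable'
  refine (norm_circleAverage_le_of_norm_le h_int fun z hz ↦ ?_).trans_eq ?_
  · rw [hR] at hz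
    rw [norm_smul, Real.norm_of_nonneg (hnonneg z hz)]
    exact mul_le_mul_of_nonneg_left (hB z hz) (hnonneg z hz)
  · exact InnerProductSpace.HarmonicContOnCl.circleAverage_poissonKernel_smul
      InnerProductSpace.harmonicContOnCl_const hu

theorem hasSum_circleCoeff (hf : ContinuousOn f (sphere 0 1)) (hsum : Summable (circleCoeff f))
    {w : ℂ} (hw : ‖w‖ = 1) : HasSum (fun k : ℤ ↦ circleCoeff f k * w ^ k) (f w) := by
  have : Fact (0 < 2 * Real.pi) := ⟨by positivity⟩
  let F : C(AddCircle (2 * Real.pi), ℂ) := ⟨fun x ↦ f (AddCircle.toCircle x),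
    hf.comp_continuous (continuous_subtype_val.comp AddCircle.continuous_toCircle)
      fun _ ↦ mem_sphere_zero_iff_norm.mpr (Circle.norm_coe _)⟩
  have htoCircle (x : ℝ) :
      (AddCircle.toCircle (x : AddCircle (2 * Real.pi)) : ℂ) = circleMap 0 1 x := by
    rw [AddCircle.toCircle_apply_mk, div_self (by positivity), one_mul, Circle.coe_exp]
    simp [circleMap]
  have hF (x : ℝ) : F x = f (circleMap 0 1 x) := congrArg f (htoCircle x)
  have hfourier (k : ℤ) (x : ℝ) :
      fourier k (x : AddCircle (2 * Real.pi)) = circleMap 0 1 x ^ k := by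
    rw [fourier_apply, AddCircle.toCircle_zsmul, Circle.coe_zpow, htoCircle]
  have hcoeff : fourierCoeff F = circleCoeff f := by
    ext k
    rw [fourierCoeff_eq_intervalIntegral F k 0, circleCoeff, Real.circleAverage_def, zero_add,
      one_div]
    refine congrArg _ (intervalIntegral.integral_congr fun x _ ↦ ?_)
    simp only [hfourier, smul_eq_mul, hF]
  have hw' : circleMap 0 1 (arg w) = w := by
    simpa [circleMap, hw] using norm_mul_exp_arg_mul_I w
  have h := has_pointwise_sum_fourier_series_of_summable (hcoeff ▸ hsum)
    ((arg w : ℝ) : AddCircle (2 * Real.pi))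
  simpa only [hcoeff, hfourier, smul_eq_mul, hF, hw'] using h

theorem norm_tsum_pow_natAbs_sub_mul_circleCoeff_le {q : ℝ} (hq0 : 0 ≤ q) (hq1 : q < 1)
    (hf : ContinuousOn f (sphere 0 1)) (hB : ∀ z, ‖z‖ = 1 → ‖f z‖ ≤ B) {w : ℂ} (hw : ‖w‖ = 1)
    (n : ℤ) : ‖∑' k : ℤ, ((q ^ (k - n).natAbs : ℝ) : ℂ) * (circleCoeff f k * w ^ k)‖ ≤ B := by
  have hw0 : w ≠ 0 := norm_ne_zero_iff.mp (hw ▸ one_ne_zero)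
  have hshift : ContinuousOn (fun z ↦ z ^ (-n) * f z) (sphere 0 1) :=
    (continuousOn_id.zpow₀ _ fun z hz ↦ .inl (ne_of_mem_sphere hz one_ne_zero)).mul hf
  have hterm (k : ℤ) : ((q ^ (k - n).natAbs : ℝ) : ℂ) * (circleCoeff f k * w ^ k) =
      w ^ n * ((q ^ (k - n).natAbs : ℂ) *
        (circleCoeff (fun z ↦ z ^ (-n) * f z) (k - n) * w ^ (k - n))) := by
    rw [circleCoeff_zpow_mul, sub_neg_eq_add, sub_add_cancel, zpow_sub₀ hw0, ofReal_pow]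
    field_simp
  have htsum := (Equiv.subRight n).tsum_eq fun j ↦ (q ^ j.natAbs : ℂ) *
    (circleCoeff (fun z ↦ z ^ (-n) * f z) j * w ^ j)
  simp only [Equiv.subRight_apply] at htsum
  simp only [hterm, tsum_mul_left]
  rw [htsum,
    (hasSum_circleAverage_poissonKernel hq0 hq1 hshift hw).tsum_eq, norm_mul, norm_zpow, hw,
    one_zpow, one_mul]
  refine norm_circleAverage_poissonKernel_le ?_ fun z hz ↦ ?_
  · simpa [hw, abs_of_nonneg hq0] using hq1
  · have hz : ‖z‖ = 1 := by simpa using hz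
    simpa [hz] using hB z hz

end UnitCircle

/-- A Fourier multiplier of norm at most `2 * q ^ n` which coincides with the Poisson multiplier
`q ^ |k|` at all frequencies `|k| ≥ n`: its kernel is `2 * cos (n * θ) / (q ^ n + q ^ (-n))` times
the Poisson kernel. -/
noncomputable def tailWeight (q : ℝ) (n : ℕ) (k : ℤ) : ℝ :=
  (q ^ n + (q ^ n)⁻¹)⁻¹ * (q ^ (k - n).natAbs + q ^ (k + n).natAbs)

section tailWeight

variable {q : ℝ} {n : ℕ}

theorem tailWeight_eq_pow_natAbs (hq0 : 0 < q) {k : ℤ} (hk : n ≤ k.natAbs) :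
    tailWeight q n k = q ^ k.natAbs := by
  have hpos : 0 < q ^ n + (q ^ n)⁻¹ := by positivity
  obtain ⟨m, hm⟩ := Nat.exists_eq_add_of_le hk
  have hfactor : q ^ m + q ^ (n + m + n) = (q ^ n + (q ^ n)⁻¹) * q ^ k.natAbs := by
    rw [hm]
    field_simp
    ring
  have hpow : q ^ (k - n).natAbs + q ^ (k + n).natAbs = q ^ m + q ^ (n + m + n) := by
    rcases le_total 0 k with h | h
    · rw [show (k - n).natAbs = m by omega, show (k + n).natAbs = n + m + n by omega]
    · rw [show (k - n).natAbs = n + m + n by omega, show (k + n).natAbs = m by omega, add_comm]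
  rw [tailWeight, hpow, hfactor, inv_mul_cancel_left₀ hpos.ne']

theorem summable_tailWeight (hq0 : 0 ≤ q) (hq1 : q < 1) : Summable (tailWeight q n) := by
  have hadd := summable_pow_natAbs_sub hq0 hq1 (-n)
  simp only [sub_neg_eq_add] at hadd
  exact ((summable_pow_natAbs_sub hq0 hq1 n).add hadd).mul_left _

theorem norm_tsum_tailWeight_mul_circleCoeff_le (hq0 : 0 < q) (hq1 : q < 1) {f : ℂ → ℂ} {B : ℝ}
    (hf : ContinuousOn f (sphere 0 1)) (hB : ∀ z, ‖z‖ = 1 → ‖f z‖ ≤ B) {w : ℂ} (hw : ‖w‖ = 1) :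
    ‖∑' k : ℤ, (tailWeight q n k : ℂ) * (circleCoeff f k * w ^ k)‖ ≤ 2 * q ^ n * B := by
  have : 0 ≤ B := (norm_nonneg _).trans (hB w hw)
  have hpos : 0 < q ^ n + (q ^ n)⁻¹ := by positivity
  have hsummable (j : ℤ) : Summable fun k : ℤ ↦
      ((q ^ (k - j).natAbs : ℝ) : ℂ) * (circleCoeff f k * w ^ k) :=
    summable_mul_circleCoeff hB hw
      (summable_pow_natAbs_sub hq0.le hq1 j)
  have hterm (k : ℤ) : (tailWeight q n k : ℂ) * (circleCoeff f k * w ^ k) =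
      ((q ^ n + (q ^ n)⁻¹)⁻¹ : ℝ) *
        (((q ^ (k - n).natAbs : ℝ) : ℂ) * (circleCoeff f k * w ^ k) +
          ((q ^ (k - (-n)).natAbs : ℝ) : ℂ) * (circleCoeff f k * w ^ k)) := by
    rw [tailWeight, sub_neg_eq_add]
    push_cast
    ring
  simp only [hterm, tsum_mul_left]
  rw [(hsummable n).tsum_add (hsummable (-n)), norm_mul, norm_real,
    Real.norm_of_nonneg (inv_nonneg.mpr hpos.le)]
  calc _ ≤ q ^ n * (B + B) := by
        gcongr
        · rw [inv_le_comm₀ hpos (by positivity)]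
          linarith [pow_pos hq0 n]
        · exact norm_add_le_of_le
            (norm_tsum_pow_natAbs_sub_mul_circleCoeff_le hq0.le hq1 hf hB hw n)
            (norm_tsum_pow_natAbs_sub_mul_circleCoeff_le hq0.le hq1 hf hB hw (-n))
    _ = 2 * q ^ n * B := by ring

end tailWeight

end FourierSeries

section Annulus

open Complex MeasureTheory Metric Set

/-- The open annulus with radii `r⁻¹` and `r`, on which a function of the Bernstein region lives
after substituting the Joukowski map. -/
def annulus (r : ℝ) : Set ℂ :=
  {w | r⁻¹ < ‖w‖ ∧ ‖w‖ < r}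

variable {r : ℝ}

theorem isOpen_annulus : IsOpen (annulus r) :=
  (isOpen_lt continuous_const continuous_norm).inter (isOpen_lt continuous_norm continuous_const)

theorem closure_annulus (hr : 1 < r) : closure (annulus r) = {w | r⁻¹ ≤ ‖w‖ ∧ ‖w‖ ≤ r} := by
  have hr_inv : r⁻¹ < r := (inv_lt_one_of_one_lt₀ hr).trans hr
  have hr_inv_pos : 0 < r⁻¹ := inv_pos.mpr (one_pos.trans hr)
  refine Subset.antisymm (closure_minimal (fun w hw ↦ ⟨hw.1.le, hw.2.le⟩)
    ((isClosed_le continuous_const continuous_norm).inter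
      (isClosed_le continuous_norm continuous_const))) fun w hw ↦ ?_
  have hw0 : 0 < ‖w‖ := hr_inv_pos.trans_le hw.1
  have hmem : ‖w‖ ∈ closure (Ioo r⁻¹ r) := by rwa [closure_Ioo hr_inv.ne]
  have hmaps : MapsTo (fun t : ℝ ↦ t * (w / ‖w‖)) (Ioo r⁻¹ r) (annulus r) := fun t ht ↦ by
    have : ‖(t : ℂ) * (w / ‖w‖)‖ = t := by
      simp [hw0.ne', abs_of_pos (hr_inv_pos.trans ht.1)]
    exact ⟨this.symm ▸ ht.1, this.symm ▸ ht.2⟩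
  have hw_eq : (‖w‖ : ℂ) * (w / ‖w‖) = w :=
    mul_div_cancel₀ w (ofReal_ne_zero.mpr hw0.ne')
  simpa only [hw_eq] using map_mem_closure (by fun_prop) hmem hmaps

theorem ne_zero_of_mem_closure_annulus (hr : 1 < r) {w : ℂ} (hw : w ∈ closure (annulus r)) :
    w ≠ 0 := by
  rw [closure_annulus hr] at hw
  exact norm_pos_iff.mp ((inv_pos.mpr (one_pos.trans hr)).trans_le hw.1)

theorem mem_closure_annulus_of_norm_eq_one (hr : 1 < r) {w : ℂ} (hw : ‖w‖ = 1) :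
    w ∈ closure (annulus r) := by
  rw [closure_annulus hr, mem_ofPred_eq, hw]
  exact ⟨inv_le_one_of_one_le₀ hr.le, hr.le⟩

theorem ofReal_mul_mem_closure_annulus (hr : 1 < r) {s : ℝ} (hs : s ∈ Icc r⁻¹ r) {z : ℂ}
    (hz : ‖z‖ = 1) : s * z ∈ closure (annulus r) := by
  have hs0 : 0 ≤ s := (inv_pos.mpr (one_pos.trans hr)).le.trans hs.1
  rw [closure_annulus hr, mem_ofPred_eq, norm_mul, hz, mul_one, norm_real, Real.norm_of_nonneg hs0]
  exact hs

variable {g : ℂ → ℂ} {L : ℝ}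

theorem norm_le_of_mem_closure_annulus (hr : 1 < r) (hg : DiffContOnCl ℂ g (annulus r))
    (hL : ∀ w, ‖w‖ = r ∨ ‖w‖ = r⁻¹ → ‖g w‖ ≤ L) {w : ℂ} (hw : w ∈ closure (annulus r)) :
    ‖g w‖ ≤ L := by
  refine norm_le_of_forall_mem_frontier_norm_le
    ((isBounded_ball (x := 0) (r := r)).subset fun w hw ↦ mem_ball_zero_iff.mpr hw.2) hg
    (fun w hw ↦ hL w ?_) hw
  rw [frontier, isOpen_annulus.interior_eq, closure_annulus hr] at hw
  have hnot : ¬(r⁻¹ < ‖w‖ ∧ ‖w‖ < r) := hw.2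
  rcases hw.1.1.eq_or_lt with h | h
  · exact .inr h.symm
  · exact .inl (hw.1.2.antisymm (not_lt.mp fun h' ↦ hnot ⟨h, h'⟩))

theorem circleAverage_eq_of_diffContOnCl_annulus (hr : 1 < r) (hg : DiffContOnCl ℂ g (annulus r))
    {s s' : ℝ} (hs : s ∈ Icc r⁻¹ r) (hs' : s' ∈ Icc r⁻¹ r) :
    Real.circleAverage g 0 s = Real.circleAverage g 0 s' := by
  wlog hle : s ≤ s' generalizing s s'
  · exact (this hs' hs (le_of_not_ge hle)).symm
  have hs_pos : 0 < s := (inv_pos.mpr (one_pos.trans hr)).trans_le hs.1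
  rw [Real.circleAverage_eq_circleIntegral hs_pos.ne',
    Real.circleAverage_eq_circleIntegral (hs_pos.trans_le hle).ne',
    circleIntegral_sub_center_inv_smul_eq_of_differentiable_on_annulus_off_countable hs_pos hle
      countable_empty]
  · refine hg.2.mono fun z hz ↦ ?_
    simp only [mem_sdiff, mem_closedBall_zero_iff, mem_ball_zero_iff, not_lt] at hz
    rw [closure_annulus hr]
    exact ⟨hs.1.trans hz.2, hz.1.trans hs'.2⟩
  · intro z hz
    simp only [mem_sdiff, mem_closedBall_zero_iff, mem_ball_zero_iff, not_le,
      mem_empty_iff_false, not_false_eq_true, and_true] at hz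
    exact hg.1.differentiableAt
      (isOpen_annulus.mem_nhds ⟨hs.1.trans_lt hz.2, hz.1.trans_le hs'.2⟩)

theorem circleCoeff_comp_ofReal_mul (hr : 1 < r) (hg : DiffContOnCl ℂ g (annulus r)) {s : ℝ}
    (hs : s ∈ Icc r⁻¹ r) (k : ℤ) :
    circleCoeff (fun z ↦ g (s * z)) k = (s : ℂ) ^ k * circleCoeff g k := by
  have hs0 : (s : ℂ) ≠ 0 :=
    ofReal_ne_zero.mpr ((inv_pos.mpr (one_pos.trans hr)).trans_le hs.1).ne'
  have hdiff : DiffContOnCl ℂ (fun z ↦ z ^ (-k) * g z) (annulus r) := by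
    refine DiffContOnCl.smul (c := fun z : ℂ ↦ z ^ (-k)) ?_ hg
    exact DifferentiableOn.diffContOnCl fun z hz ↦ (differentiableAt_zpow.mpr
      (.inl (ne_zero_of_mem_closure_annulus hr hz))).differentiableWithinAt
  have hone : (1 : ℝ) ∈ Icc r⁻¹ r := ⟨inv_le_one_of_one_le₀ hr.le, hr.le⟩
  rw [circleCoeff, circleCoeff, ← circleAverage_eq_of_diffContOnCl_annulus hr hdiff hs hone,
    Real.circleAverage_eq_circleAverage_zero_one (R := s), ← smul_eq_mul,
    ← Real.circleAverage_fun_smul]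
  congr 1
  ext z
  rw [add_zero, mul_zpow, smul_eq_mul, ← mul_assoc, ← mul_assoc, zpow_neg, zpow_neg,
    mul_inv_cancel₀ (zpow_ne_zero k hs0), one_mul]

theorem norm_circleCoeff_le_mul_pow (hr : 1 < r) (hg : DiffContOnCl ℂ g (annulus r))
    (hL : ∀ w ∈ closure (annulus r), ‖g w‖ ≤ L) (k : ℤ) :
    ‖circleCoeff g k‖ ≤ L * r⁻¹ ^ k.natAbs := by
  have hr_inv : r⁻¹ ≤ r := (inv_lt_one_of_one_lt₀ hr).le.trans hr.le
  have : 0 < r := one_pos.trans hr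
  obtain ⟨s, hs, hsk⟩ : ∃ s ∈ Icc r⁻¹ r, s ^ k = r ^ k.natAbs := by
    rcases le_total 0 k with hk | hk
    · exact ⟨r, right_mem_Icc.mpr hr_inv, by rw [← zpow_natCast, Int.natAbs_of_nonneg hk]⟩
    · exact ⟨r⁻¹, left_mem_Icc.mpr hr_inv, by
        rw [← zpow_natCast, Int.ofNat_natAbs_of_nonpos hk, inv_zpow, zpow_neg]⟩
  have h := norm_circleCoeff_le
    (fun z hz ↦ hL _ (ofReal_mul_mem_closure_annulus hr hs hz)) k (f := fun z ↦ g (s * z))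
  rw [circleCoeff_comp_ofReal_mul hr hg hs, ← ofReal_zpow, hsk, norm_mul, norm_real,
    Real.norm_of_nonneg (by positivity)] at h
  rw [inv_pow, ← div_eq_mul_inv]
  exact (le_div_iff₀' (by positivity)).mpr h

/-- The Fourier multiplier carried by the remainder of the trigonometric approximation. It equals
`1` at all frequencies `|k| ≥ n`; the factors `r ^ k` and `r⁻¹ ^ k` stand for evaluation on the
circles of radii `r` and `r⁻¹`. -/
noncomputable def tailMultiplier (r : ℝ) (n : ℕ) (k : ℤ) : ℝ :=
  tailWeight r⁻¹ n k * (r ^ k + r⁻¹ ^ k) - tailWeight (r⁻¹ ^ 2) n k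

theorem tailMultiplier_eq_one (hr : 1 < r) {n : ℕ} {k : ℤ} (hk : n ≤ k.natAbs) :
    tailMultiplier r n k = 1 := by
  have hr_pos : 0 < r := one_pos.trans hr
  have hzpow : r ^ k + r⁻¹ ^ k = (r⁻¹ ^ k.natAbs)⁻¹ + r⁻¹ ^ k.natAbs := by
    obtain ⟨m, rfl | rfl⟩ := k.eq_nat_or_neg
    · simp
    · simp [add_comm]
  rw [tailMultiplier, tailWeight_eq_pow_natAbs (inv_pos.mpr hr_pos) hk,
    tailWeight_eq_pow_natAbs (by positivity) hk, hzpow, mul_add,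
    mul_inv_cancel₀ (by positivity)]
  ring

theorem exists_hasSum_tailMultiplier (hr : 1 < r) (hg : DiffContOnCl ℂ g (annulus r))
    (hL : ∀ w ∈ closure (annulus r), ‖g w‖ ≤ L) (n : ℕ) {w : ℂ} (hw : ‖w‖ = 1) :
    ∃ U, HasSum (fun k : ℤ ↦ (tailMultiplier r n k : ℂ) * (circleCoeff g k * w ^ k)) U ∧
      ‖U‖ ≤ 6 * L * r⁻¹ ^ n := by
  have hq0 : 0 < r⁻¹ := inv_pos.mpr (one_pos.trans hr)
  have hq1 : r⁻¹ < 1 := inv_lt_one_of_one_lt₀ hr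
  have hcircle {q : ℝ} (hq0 : 0 < q) (hq1 : q < 1) {s : ℝ} (hs : s ∈ Icc r⁻¹ r) :
      ∃ U, HasSum (fun k : ℤ ↦ (tailWeight q n k : ℂ) * ((s : ℂ) ^ k * circleCoeff g k * w ^ k))
        U ∧ ‖U‖ ≤ 2 * q ^ n * L := by
    have hmem {z : ℂ} (hz : ‖z‖ = 1) := ofReal_mul_mem_closure_annulus hr hs hz
    have hcont : ContinuousOn (fun z ↦ g (s * z)) (sphere 0 1) :=
      hg.2.comp (by fun_prop) fun z hz ↦ hmem (mem_sphere_zero_iff_norm.mp hz)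
    have hbound : ∀ z : ℂ, ‖z‖ = 1 → ‖g (s * z)‖ ≤ L := fun z hz ↦ hL _ (hmem hz)
    simp only [← circleCoeff_comp_ofReal_mul hr hg hs]
    exact ⟨_, (summable_mul_circleCoeff hbound hw (summable_tailWeight hq0.le hq1)).hasSum,
      norm_tsum_tailWeight_mul_circleCoeff_le hq0 hq1 hcont hbound hw⟩
  have hr_inv : r⁻¹ ≤ r := hq1.le.trans hr.le
  obtain ⟨U₁, hU₁, hU₁L⟩ := hcircle hq0 hq1 (right_mem_Icc.mpr hr_inv)
  obtain ⟨U₂, hU₂, hU₂L⟩ := hcircle hq0 hq1 (left_mem_Icc.mpr hr_inv)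
  obtain ⟨U₃, hU₃, hU₃L⟩ := hcircle (pow_pos hq0 2) (pow_lt_one₀ hq0.le hq1 two_ne_zero)
    (⟨hq1.le, hr.le⟩ : (1 : ℝ) ∈ Icc r⁻¹ r)
  refine ⟨U₁ + U₂ - U₃, ?_, ?_⟩
  · refine ((hU₁.add hU₂).sub hU₃).congr_fun fun k ↦ ?_
    simp only [tailMultiplier, ofReal_one, one_zpow]
    push_cast
    ring
  · have hL0 : 0 ≤ L := (norm_nonneg _).trans (hL w (mem_closure_annulus_of_norm_eq_one hr hw))
    have hsq : (r⁻¹ ^ 2) ^ n ≤ r⁻¹ ^ n :=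
      pow_le_pow_left₀ (by positivity) (pow_le_of_le_one hq0.le hq1.le two_ne_zero) n
    calc ‖U₁ + U₂ - U₃‖ ≤ 2 * r⁻¹ ^ n * L + 2 * r⁻¹ ^ n * L + 2 * (r⁻¹ ^ 2) ^ n * L :=
          norm_sub_le_of_le (norm_add_le_of_le hU₁L hU₂L) hU₃L
      _ ≤ 2 * r⁻¹ ^ n * L + 2 * r⁻¹ ^ n * L + 2 * r⁻¹ ^ n * L := by gcongr
      _ = 6 * L * r⁻¹ ^ n := by ring

theorem exists_norm_sub_sum_zpow_le (hr : 1 < r) (hg : DiffContOnCl ℂ g (annulus r))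
    (hL : ∀ w ∈ closure (annulus r), ‖g w‖ ≤ L) (n : ℕ) :
    ∃ d : ℤ → ℂ, ∀ w : ℂ, ‖w‖ = 1 →
      ‖g w - ∑ k ∈ Finset.Ioo (-(n : ℤ)) n, d k * w ^ k‖ ≤ 6 * L * r⁻¹ ^ n := by
  refine ⟨fun k ↦ (1 - tailMultiplier r n k) * circleCoeff g k, fun w hw ↦ ?_⟩
  obtain ⟨U, hU, hUL⟩ := exists_hasSum_tailMultiplier hr hg hL n hw
  have hcont : ContinuousOn g (sphere 0 1) := hg.2.mono fun z hz ↦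
    mem_closure_annulus_of_norm_eq_one hr (mem_sphere_zero_iff_norm.mp hz)
  have hsummable : Summable (circleCoeff g) := .of_norm_bounded
    ((summable_pow_natAbs (inv_nonneg.mpr (one_pos.trans hr).le)
      (inv_lt_one_of_one_lt₀ hr)).mul_left L) (norm_circleCoeff_le_mul_pow hr hg hL)
  have htrunc : HasSum (fun k : ℤ ↦ (1 - tailMultiplier r n k) * circleCoeff g k * w ^ k)
      (∑ k ∈ Finset.Ioo (-(n : ℤ)) n, (1 - tailMultiplier r n k) * circleCoeff g k * w ^ k) := by
    refine hasSum_sum_of_ne_finset_zero fun k hk ↦ ?_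
    have hk : n ≤ k.natAbs := by
      rw [Finset.mem_Ioo] at hk
      omega
    rw [tailMultiplier_eq_one hr hk, ofReal_one, sub_self, zero_mul, zero_mul]
  have hsub : U = g w -
      ∑ k ∈ Finset.Ioo (-(n : ℤ)) n, (1 - tailMultiplier r n k) * circleCoeff g k * w ^ k := by
    refine hU.unique ?_
    refine ((hasSum_circleCoeff hcont hsummable hw).sub htrunc).congr_fun fun k ↦ ?_
    ring
  exact hsub ▸ hUL

end Annulus

section Bernstein

open Complex Polynomial Set

/-- The Joukowski map, which sends the circles of radii `ρ` and `ρ⁻¹` onto the Bernstein ellipse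
and the unit circle onto `[-1, 1]`. -/
noncomputable def joukowski (w : ℂ) : ℂ :=
  (w + w⁻¹) / 2

section Joukowski

theorem joukowski_inv (w : ℂ) : joukowski w⁻¹ = joukowski w := by
  rw [joukowski, joukowski, inv_inv, add_comm]

theorem joukowski_exp_mul_I (θ : ℝ) : joukowski (exp (θ * I)) = Real.cos θ := by
  rw [joukowski, ← exp_neg, ofReal_cos, Complex.cos, neg_mul]

theorem differentiableAt_joukowski {w : ℂ} (hw : w ≠ 0) : DifferentiableAt ℂ joukowski w :=
  (differentiableAt_id.add (differentiableAt_inv hw)).div_const 2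

theorem norm_joukowski_sub_add_norm {w : ℂ} (hw : w ≠ 0) :
    ‖joukowski w - 1‖ + ‖joukowski w + 1‖ = ‖w‖ + ‖w‖⁻¹ := by
  have hsub : joukowski w - 1 = (w - 1) ^ 2 / (2 * w) := by
    rw [joukowski]
    field_simp
    ring
  have hadd : joukowski w + 1 = (w + 1) ^ 2 / (2 * w) := by
    rw [joukowski]
    field_simp
    ring
  have hparallelogram := parallelogram_law_with_norm ℝ w 1
  have hnorm : ‖w‖ ≠ 0 := norm_ne_zero_iff.mpr hw
  rw [norm_one] at hparallelogram
  rw [hsub, hadd, norm_div, norm_div, norm_pow, norm_pow, norm_mul, Complex.norm_ofNat]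
  field_simp
  linarith

theorem bernsteinPoint_eq_joukowski (ρ θ : ℝ) :
    bernsteinPoint ρ θ = joukowski (ρ * exp (θ * I)) := by
  rw [bernsteinPoint, joukowski, mul_inv, ← exp_neg, mul_comm I]
  ring

variable {ρ : ℝ}

theorem mapsTo_joukowski (hρ : 1 < ρ) :
    MapsTo joukowski (annulus ρ) (bernsteinRegion ρ) := by
  rintro w ⟨hinv, hlt⟩
  have hρ0 : 0 < ρ := one_pos.trans hρ
  have hw0 : 0 < ‖w‖ := (inv_pos.mpr hρ0).trans hinv
  have hfactor : ρ + ρ⁻¹ - (‖w‖ + ‖w‖⁻¹) = (ρ - ‖w‖) * (‖w‖ - ρ⁻¹) / ‖w‖ := by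
    field_simp
    ring
  have hpos : 0 < (ρ - ‖w‖) * (‖w‖ - ρ⁻¹) / ‖w‖ :=
    div_pos (mul_pos (sub_pos.mpr hlt) (sub_pos.mpr hinv)) hw0
  rw [bernsteinRegion, mem_ofPred_eq, norm_joukowski_sub_add_norm (norm_pos_iff.mp hw0)]
  linarith

theorem exists_bernsteinPoint_eq_joukowski {w : ℂ} (hw : ‖w‖ = ρ) :
    ∃ θ ∈ Icc 0 (2 * Real.pi), bernsteinPoint ρ θ = joukowski w := by
  have hmem : w ∈ circleMap 0 ρ '' Ioc 0 (2 * Real.pi) := by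
    rw [image_circleMap_Ioc, mem_sphere_zero_iff_norm, ← hw, abs_norm]
  obtain ⟨θ, hθ, rfl⟩ := hmem
  exact ⟨θ, Ioc_subset_Icc_self hθ, by rw [bernsteinPoint_eq_joukowski, circleMap_zero]⟩

variable {F : ℂ → ℂ} {L : ℝ}

theorem diffContOnCl_comp_joukowski (hρ : 1 < ρ) (hF : DiffContOnCl ℂ F (bernsteinRegion ρ)) :
    DiffContOnCl ℂ (F ∘ joukowski) (annulus ρ) :=
  hF.comp (DifferentiableOn.diffContOnCl fun _ hw ↦ (differentiableAt_joukowski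
    (ne_zero_of_mem_closure_annulus hρ hw)).differentiableWithinAt) (mapsTo_joukowski hρ)

theorem norm_comp_joukowski_le (hρ : 1 < ρ) (hF : DiffContOnCl ℂ F (bernsteinRegion ρ))
    (hL : ∀ θ ∈ Icc (0 : ℝ) (2 * Real.pi), ‖F (bernsteinPoint ρ θ)‖ ≤ L) {w : ℂ}
    (hw : w ∈ closure (annulus ρ)) : ‖F (joukowski w)‖ ≤ L := by
  have hcircle {w : ℂ} (hw : ‖w‖ = ρ) : ‖F (joukowski w)‖ ≤ L := by
    obtain ⟨θ, hθ, hθw⟩ := exists_bernsteinPoint_eq_joukowski hw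
    exact hθw ▸ hL θ hθ
  refine norm_le_of_mem_closure_annulus hρ (diffContOnCl_comp_joukowski hρ hF)
    (fun w hw ↦ hw.elim hcircle fun hw ↦ ?_) hw
  rw [Function.comp_apply, ← joukowski_inv]
  exact hcircle (by rw [norm_inv, hw, inv_inv])

end Joukowski

/-- The Chebyshev expansion with coefficients `Re (d k)` at the frequencies `|k| < n`. It is what
the real part of the trigonometric sum `∑ k, d k * exp (k * θ * I)` becomes in the variable
`cos θ` after symmetrization in `θ`. -/
noncomputable def chebyshevSum (d : ℤ → ℂ) (n : ℕ) : ℝ[X] :=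
  ∑ k ∈ Finset.Ioo (-(n : ℤ)) n, (d k).re • Chebyshev.T ℝ k

theorem degree_chebyshevSum_lt (d : ℤ → ℂ) (n : ℕ) : (chebyshevSum d n).degree < n := by
  refine mem_degreeLT.mp (Submodule.sum_mem _ fun k hk ↦ Submodule.smul_mem _ _ ?_)
  rw [mem_degreeLT, Chebyshev.degree_T]
  rw [Finset.mem_Ioo] at hk
  exact_mod_cast (by omega : k.natAbs < n)

theorem eval_cos_chebyshevSum (d : ℤ → ℂ) (n : ℕ) (θ : ℝ) :
    (chebyshevSum d n).eval (Real.cos θ) =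
      ((∑ k ∈ Finset.Ioo (-(n : ℤ)) n, d k * exp (θ * I) ^ k +
        ∑ k ∈ Finset.Ioo (-(n : ℤ)) n, d k * (exp (θ * I))⁻¹ ^ k) / 2).re := by
  rw [chebyshevSum, eval_finsetSum, ← Finset.sum_add_distrib, Finset.sum_div, re_sum]
  refine Finset.sum_congr rfl fun k _ ↦ ?_
  have hcos : (d k * exp (θ * I) ^ k + d k * (exp (θ * I))⁻¹ ^ k) / 2 =
      d k * (Real.cos (k * θ) : ℂ) := by
    rw [← joukowski_exp_mul_I, joukowski, inv_zpow, ← exp_int_mul]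
    push_cast
    ring_nf
  rw [hcos, re_mul_ofReal, eval_smul, Chebyshev.T_real_cos, smul_eq_mul]

theorem exists_polynomial_abs_sub_le {ρ : ℝ} (hρ : 1 < ρ) {F : ℂ → ℂ}
    (hF : DiffContOnCl ℂ F (bernsteinRegion ρ)) {L : ℝ}
    (hL : ∀ θ ∈ Icc (0 : ℝ) (2 * Real.pi), ‖F (bernsteinPoint ρ θ)‖ ≤ L) {f : ℝ → ℝ}
    (hf : ∀ t ∈ Icc (-1 : ℝ) 1, F t = f t) (n : ℕ) :
    ∃ p : ℝ[X], p.degree < n ∧ ∀ t ∈ Icc (-1) 1, |f t - p.eval t| ≤ 6 * L * ρ⁻¹ ^ n := by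
  obtain ⟨d, hd⟩ := exists_norm_sub_sum_zpow_le hρ (diffContOnCl_comp_joukowski hρ hF)
    (fun w hw ↦ norm_comp_joukowski_le hρ hF hL hw) n
  refine ⟨chebyshevSum d n, degree_chebyshevSum_lt d n, fun t ht ↦ ?_⟩
  obtain ⟨θ, rfl⟩ : ∃ θ, Real.cos θ = t := ⟨Real.arccos t, Real.cos_arccos ht.1 ht.2⟩
  have hw : ‖exp (θ * I)‖ = 1 := norm_exp_ofReal_mul_I θ
  have h := hd _ hw
  have h_inv := hd (exp (θ * I))⁻¹ (by rw [norm_inv, hw, inv_one])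
  rw [Function.comp_apply, joukowski_exp_mul_I, hf _ ht] at h
  rw [Function.comp_apply, joukowski_inv, joukowski_exp_mul_I, hf _ ht] at h_inv
  rw [eval_cos_chebyshevSum, ← ofReal_re (f (Real.cos θ)), ← sub_re]
  refine (abs_re_le_norm _).trans ?_
  rw [show ∀ a b c : ℂ, a - (b + c) / 2 = ((a - b) + (a - c)) / 2 by intros; ring, norm_div,
    Complex.norm_ofNat, div_le_iff₀ two_pos, mul_two]
  exact norm_add_le_of_le h h_inv

end Bernstein

section Threshold

variable {ρ L ε C : ℝ} {N : ℕ}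

theorem mul_le_mul_pow_of_mul_one_add_logb_le (hC : 1 ≤ C) (hρ : 1 < ρ) (hL : 0 ≤ L) (hε : 0 < ε)
    (hN : C * (1 + Real.logb ρ (1 + L / ε)) ≤ N) : C * L ≤ ε * ρ ^ N := by
  have hquot : 0 ≤ L / ε := by positivity
  have hρ0 : 0 < ρ := one_pos.trans hρ
  have hpow : 1 + C * (L / ε) ≤ ρ ^ N :=
    calc 1 + C * (L / ε) ≤ (1 + L / ε) ^ C :=
          one_add_mul_self_le_rpow_one_add (by linarith) hC
      _ = ρ ^ (C * Real.logb ρ (1 + L / ε)) := by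
          rw [mul_comm, Real.rpow_mul hρ0.le, Real.rpow_logb hρ0 hρ.ne' (by positivity)]
      _ ≤ ρ ^ (N : ℝ) := Real.rpow_le_rpow_of_exponent_le hρ.le (by linarith)
      _ = ρ ^ N := Real.rpow_natCast ρ N
  calc C * L = ε * (C * (L / ε)) := by field_simp
    _ ≤ ε * ρ ^ N := by
        gcongr
        linarith

theorem pos_of_mul_one_add_logb_le (hC : 0 < C) (hρ : 1 < ρ) (hL : 0 ≤ L) (hε : 0 < ε)
    (hN : C * (1 + Real.logb ρ (1 + L / ε)) ≤ N) : 0 < N := by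
  have hlog : 0 ≤ Real.logb ρ (1 + L / ε) :=
    Real.logb_nonneg hρ (le_add_of_nonneg_right (by positivity))
  exact Nat.cast_pos.mp ((by positivity : 0 < C * (1 + Real.logb ρ (1 + L / ε))).trans_le hN)

end Threshold

section QuadratureError

open Set

theorem abs_integral_sub_sum_le_of_bernstein {N : ℕ} {t w : Fin N → ℝ}
    (h : IsGaussQuadrature N t w) (hN : 0 < N) {ρ : ℝ} (hρ : 1 < ρ) {F : ℂ → ℂ}
    (hF : DiffContOnCl ℂ F (bernsteinRegion ρ)) {L : ℝ}
    (hL : ∀ θ ∈ Icc (0 : ℝ) (2 * Real.pi), ‖F (bernsteinPoint ρ θ)‖ ≤ L) {f : ℝ → ℝ}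
    (hf : ∀ t ∈ Icc (-1 : ℝ) 1, F t = f t)
    (hf_int : IntervalIntegrable f MeasureTheory.volume (-1) 1) :
    |(∫ s in (-1 : ℝ)..1, f s) - ∑ k, w k * f (t k)| ≤ 24 * L * ρ⁻¹ ^ (2 * N) := by
  obtain ⟨p, hdegree, hp⟩ := exists_polynomial_abs_sub_le hρ hF hL hf (2 * N)
  refine (abs_integral_sub_sum_le (by norm_num) h.node_mem_Icc h.weight_nonneg (by positivity)
    (fun q hq ↦ h.integral_eq_sum hq) hf_int hdegree hp).trans_eq ?_
  ring

theorem HasBernsteinBound.nonneg {D : Set ℝ} {φ : ℝ → ℝ → ℝ} {ρ L : ℝ}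
    (h : HasBernsteinBound D φ ρ L) (hD : D.Nonempty) : 0 ≤ L := by
  obtain ⟨x, hx⟩ := hD
  obtain ⟨F, -, -, hF⟩ := h x hx
  exact (norm_nonneg _).trans (hF 0 ⟨le_rfl, by positivity⟩)

theorem abs_log_add_sub_sum_le {D : Set ℝ} {φ : ℝ → ℝ → ℝ} {c ρ L ε : ℝ}
    (hφ : IsGeneratingFunction D φ c) (hρ : 1 < ρ) (hB : HasBernsteinBound D φ ρ L) (hε : 0 < ε)
    {N : ℕ} (hN : 24 * (1 + Real.logb ρ (1 + L / ε)) ≤ N) {t w : Fin N → ℝ}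
    (h : IsGaussQuadrature N t w) {x : ℝ} (hx : x ∈ D) :
    |Real.log x + c - ∑ k, w k * φ (t k) x| ≤ ε := by
  have hL0 : 0 ≤ L := hB.nonneg ⟨x, hx⟩
  have hN0 : 0 < N := pos_of_mul_one_add_logb_le (by norm_num) hρ hL0 hε hN
  obtain ⟨F, hF, hFφ, hFL⟩ := hB x hx
  rw [← hφ.integral_eq x hx]
  calc |(∫ s in (-1 : ℝ)..1, φ s x) - ∑ k, w k * φ (t k) x| ≤ 24 * L * ρ⁻¹ ^ (2 * N) :=
        abs_integral_sub_sum_le_of_bernstein h hN0 hρ hF hFL hFφ (hφ.integrable x hx)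
    _ ≤ 24 * L * ρ⁻¹ ^ N := by
        gcongr 24 * L * ?_
        exact pow_le_pow_of_le_one (by positivity) (inv_le_one_of_one_le₀ hρ.le) (by omega)
    _ = 24 * L / ρ ^ N := by rw [inv_pow, div_eq_mul_inv]
    _ ≤ ε := (div_le_iff₀ (by positivity)).mpr
        (mul_le_mul_pow_of_mul_one_add_logb_le (by norm_num) hρ hL0 hε hN)

end QuadratureError

section Cone

open Set

variable {M : ℝ}

theorem div_mem_ratioRange (hM : 0 < M) {a b : ℝ} (ha : a ∈ Icc (1 / M) M)
    (hb : b ∈ Icc (1 / M) M) : a / b ∈ ratioRange M := by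
  have hpos : 0 < 1 / M := by positivity
  have hb0 : 0 < b := hpos.trans_le hb.1
  have ha0 : 0 < a := hpos.trans_le ha.1
  constructor
  · calc 1 / M ^ 2 = (1 / M) / M := by field_simp
      _ ≤ a / b := div_le_div₀ ha0.le ha.1 hb0 hb.2
  · calc a / b ≤ M / (1 / M) := div_le_div₀ hM.le ha.2 hpos hb.1
      _ = M ^ 2 := by field_simp

variable {φ : ℝ → ℝ → ℝ} {c ε : ℝ} {N : ℕ} {t w : Fin N → ℝ}

theorem Kexp_neg_subset_Ksc (hM : 0 < M)
    (herr : ∀ y ∈ ratioRange M, |Real.log y + c - ∑ k, w k * φ (t k) y| ≤ ε) :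
    Kexp M (-ε) ⊆ Ksc M φ c t w := by
  rintro x ⟨hx₀, hx₁, -, hlog⟩
  have hx₁_pos : 0 < x 1 := (one_div_pos.mpr hM).trans_le hx₁.1
  have hratio := div_mem_ratioRange hM hx₀ hx₁
  refine ⟨hx₀, hx₁, fun k ↦ x 1 * φ (t k) (x 0 / x 1), ?_,
    fun k ↦ ⟨hratio, (mul_div_cancel_left₀ _ hx₁_pos.ne').le⟩⟩
  have hsum : x 2 / x 1 + c ≤ ∑ k, w k * φ (t k) (x 0 / x 1) := by
    linarith [(abs_le.mp (herr _ hratio)).2]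
  calc x 2 + c * x 1 = x 1 * (x 2 / x 1 + c) := by field_simp
    _ ≤ x 1 * ∑ k, w k * φ (t k) (x 0 / x 1) := by gcongr
    _ = ∑ k, w k * (x 1 * φ (t k) (x 0 / x 1)) := by simp only [Finset.mul_sum, mul_left_comm]

theorem Ksc_subset_Kexp (hM : 0 < M) (hw : ∀ k, 0 ≤ w k)
    (herr : ∀ y ∈ ratioRange M, |Real.log y + c - ∑ k, w k * φ (t k) y| ≤ ε) :
    Ksc M φ c t w ⊆ Kexp M ε := by
  rintro x ⟨hx₀, hx₁, v, hv, hhyp⟩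
  have hM_inv : 0 < 1 / M := one_div_pos.mpr hM
  have hx₁_pos : 0 < x 1 := hM_inv.trans_le hx₁.1
  refine ⟨hx₀, hx₁, div_pos (hM_inv.trans_le hx₀.1) hx₁_pos, ?_⟩
  have hsum : x 2 / x 1 + c ≤ ∑ k, w k * φ (t k) (x 0 / x 1) :=
    calc x 2 / x 1 + c = (x 2 + c * x 1) / x 1 := by field_simp
      _ ≤ (∑ k, w k * v k) / x 1 := by gcongr
      _ = ∑ k, w k * (v k / x 1) := by simp only [Finset.sum_div, mul_div_assoc]
      _ ≤ ∑ k, w k * φ (t k) (x 0 / x 1) :=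
          Finset.sum_le_sum fun k _ ↦ mul_le_mul_of_nonneg_left (hhyp k).2 (hw k)
  linarith [(abs_le.mp (herr _ (div_mem_ratioRange hM hx₀ hx₁))).1]

end Cone

end ExpCone

theorem mainTheorem2 :
    ∃ C : ℝ, 0 < C ∧
      ∀ (M : ℝ) (φ : ℝ → ℝ → ℝ) (c ρ L ε : ℝ),
        1 < M →
        ExpCone.IsGeneratingFunction (ExpCone.ratioRange M) φ c →
        1 < ρ →
        ExpCone.HasBernsteinBound (ExpCone.ratioRange M) φ ρ L →
        0 < ε →
        ∀ N : ℕ, C * (1 + Real.logb ρ (1 + L / ε)) ≤ N →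
          (∃ t w : Fin N → ℝ, ExpCone.IsGaussQuadrature N t w) ∧
          ∀ t w : Fin N → ℝ, ExpCone.IsGaussQuadrature N t w →
            ExpCone.IsSOCRepresentable (ExpCone.Ksc M φ c t w) ∧
            ExpCone.Kexp M (-ε) ⊆ ExpCone.Ksc M φ c t w ∧
            ExpCone.Ksc M φ c t w ⊆ ExpCone.Kexp M ε := by
  refine ⟨24, by norm_num, fun M φ c ρ L ε hM hφ hρ hB hε N hN ↦
    ⟨ExpCone.exists_isGaussQuadrature N, fun t w h ↦ ?_⟩⟩
  have hM0 : 0 < M := one_pos.trans hM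
  have herr : ∀ y ∈ ExpCone.ratioRange M, |Real.log y + c - ∑ k, w k * φ (t k) y| ≤ ε :=
    fun y hy ↦ ExpCone.abs_log_add_sub_sum_le hφ hρ hB hε hN h hy
  exact ⟨ExpCone.isSOCRepresentable_Ksc hM0 c w fun k ↦ hφ.soc _ (h.node_mem_Icc k),
    ExpCone.Kexp_neg_subset_Ksc hM0 herr,
    ExpCone.Ksc_subset_Kexp hM0 h.weight_nonneg herr⟩
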